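/- Let $n\ge 2$, let $\mathscr{C}\subset\mathbb{R}^n$ be an $n$-dimensional simplicial cone with vertex at the origin $\boldsymbol{0}$, and suppose that $\mathscr{C}$ is irrational, that is, the planes spanned by its proper faces contain no point of $\mathbb{Z}^n$ except $\boldsymbol{0}$. Let $K$ be the convex hull of the nonzero points of $\mathbb{Z}^n$ contained in $\mathscr{C}$ (the Klein polyhedron), and let $\Pi=\partial K$ be its sail; the vertices, edges and faces of $\Pi$ are those of $K$ contained in $\Pi$. For a vertex $\mathbf{v}$ of $\Pi$ let $\mathbf{r}_1,\dots,\mathbf{r}_m$ be the primitive vectors of $\mathbb{Z}^n$ parallel to the edges of $\Pi$ incident to $\mathbf{v}$ (one for each edge), and let $$\det \mathrm{St}_{\mathbf{v}}=\sum_{1\le i_1<\dots<i_n\le m}|\det(\mathbf{r}_{i_1},\dots,\mathbf{r}_{i_n})|$$ be the determinant of the edge star of $\mathbf{v}$. For an $(n-1)$-dimensional face $F$ of $\Pi$ let $\rho_{\mathrm{int}}(F,\boldsymbol{0})$, the integer distance from $F$ to $\boldsymbol{0}$, be the index in $\mathbb{Z}^n$ of the smallest sublattice of $\mathbb{Z}^n$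 containing $\mathbb{Z}^n\cap\mathrm{aff}(F)$. Then, for every vertex $\mathbf{v}$ of $\Pi$ and every $(n-1)$-dimensional face $F$ of $\Pi$ incident to $\mathbf{v}$, this index is finite and $$\rho_{\mathrm{int}}(F,\boldsymbol{0})<(n\det \mathrm{St}_{\mathbf{v}})^{8\,n!}.$$ -/

import Mathlib

open scoped Nat

noncomputable section

namespace KleinSail

/-- The point of `ℝⁿ` with the given integer coordinates. -/
def toReal {n : ℕ} (z : Fin n → ℤ) : Fin n → ℝ := fun i => (z i : ℝ)

/-- The `n`-dimensional simplicial cone with vertex at the origin that is generated by the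
basis `b` of `ℝⁿ`: all linear combinations of the basis vectors with nonnegative coefficients. -/
def simplicialCone {n : ℕ} (b : Module.Basis (Fin n) ℝ (Fin n → ℝ)) : Set (Fin n → ℝ) :=
  {x | ∃ c : Fin n → ℝ, (∀ i, 0 ≤ c i) ∧ x = ∑ i, c i • b i}

/-- The cone generated by `b` is irrational: the plane spanned by a proper face of the cone
(the proper faces are generated by the proper subfamilies of `b`) contains no point of `ℤⁿ`
except the origin. -/
def IsIrrational {n : ℕ} (b : Module.Basis (Fin n) ℝ (Fin n → ℝ)) : Prop :=
  ∀ s : Set (Fin n), s ≠ Set.univ →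
    ∀ z : Fin n → ℤ, toReal z ∈ Submodule.span ℝ (b '' s) → z = 0

/-- The Klein polyhedron of a cone `C`: the convex hull of the nonzero points of `ℤⁿ` in `C`. -/
def kleinPolyhedron {n : ℕ} (C : Set (Fin n → ℝ)) : Set (Fin n → ℝ) :=
  convexHull ℝ {x | x ∈ C ∧ ∃ z : Fin n → ℤ, z ≠ 0 ∧ toReal z = x}

/-- The sail of a cone `C`: the boundary of its Klein polyhedron. -/
def sail {n : ℕ} (C : Set (Fin n → ℝ)) : Set (Fin n → ℝ) :=
  frontier (kleinPolyhedron C)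

/-- `F` is a `k`-dimensional face of the convex set `K`: a nonempty intersection of `K` with a
supporting hyperplane (or `K` itself), whose affine hull has dimension `k`. -/
def IsFaceOfDim {n : ℕ} (K : Set (Fin n → ℝ)) (k : ℕ) (F : Set (Fin n → ℝ)) : Prop :=
  F.Nonempty ∧ IsExposed ℝ K F ∧ Module.finrank ℝ (affineSpan ℝ F).direction = k

/-- `F` is a `k`-dimensional face of the sail of `C`: a `k`-dimensional face of the Klein
polyhedron that lies in the sail. -/
def IsSailFace {n : ℕ} (C : Set (Fin n → ℝ)) (k : ℕ) (F : Set (Fin n → ℝ)) : Prop :=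
  IsFaceOfDim (kleinPolyhedron C) k F ∧ F ⊆ sail C

/-- `v` is a vertex (a zero-dimensional face) of the sail of `C`. -/
def IsSailVertex {n : ℕ} (C : Set (Fin n → ℝ)) (v : Fin n → ℝ) : Prop :=
  IsSailFace C 0 {v}

/-- `r` is a primitive vector of `ℤⁿ`: its coordinates have no common divisor except `±1`. -/
def IsPrimitiveVector {n : ℕ} (r : Fin n → ℤ) : Prop :=
  ∀ d : ℤ, (∀ i, d ∣ r i) → IsUnit d

/-- The primitive vectors of `ℤⁿ` parallel to the edges of the sail that are incident to `v`,
one for each edge: the one that points from `v` into the edge. -/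
def edgeVectors {n : ℕ} (C : Set (Fin n → ℝ)) (v : Fin n → ℝ) : Set (Fin n → ℤ) :=
  {r | IsPrimitiveVector r ∧
    ∃ E, IsSailFace C 1 E ∧ v ∈ E ∧ ∃ t : ℝ, 0 < t ∧ v + t • toReal r ∈ E}

/-- The absolute value of the determinant of the `n` vectors in `s` (it does not depend on the
order in which they are listed). -/
def absDet {n : ℕ} (s : Finset (Fin n → ℤ)) (h : s.card = n) : ℕ :=
  (Matrix.det (Matrix.of fun i : Fin n => ((s.equivFinOfCardEq h).symm i : Fin n → ℤ))).natAbs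

/-- The determinant of the edge star of the vertex `v` of the sail of `C`: the sum of the
absolute values of the determinants of all `n`-element subfamilies of the primitive vectors
parallel to the edges incident to `v`. -/
def starDet {n : ℕ} (C : Set (Fin n → ℝ)) (v : Fin n → ℝ) : ℕ :=
  ∑ᶠ s : {s : Finset (Fin n → ℤ) // (s : Set (Fin n → ℤ)) ⊆ edgeVectors C v ∧ s.card = n},
    absDet s.1 s.2.2

/-- The integer distance from `F` to the integer point `a`: the index in `ℤⁿ` of the smallest
subgroup that contains `ℤⁿ ∩ aff F - a`; the value is `⊤` if this index is infinite. -/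
def intDist {n : ℕ} (F : Set (Fin n → ℝ)) (a : Fin n → ℤ) : ℕ∞ :=
  ENat.card ((Fin n → ℤ) ⧸
    AddSubgroup.closure {z : Fin n → ℤ | toReal (z + a) ∈ affineSpan ℝ F})

end KleinSail

end

/-!
Let `w` be a vertex of the Klein polyhedron, hence the unique minimum of a linear functional on
the lattice points of the cone. These points shifted by `-w` are generated, up to nonnegative
combinations, by the finitely many primitive edge vectors at `w`. As `2w` is again a lattice point
of the cone, `w = ∑ c k • r k` with at most `n` linearly independent edge vectors `r k` and
coefficients `c k ≥ 0`.

The sum of the `c k` is not large. Put `S = 1 + ∑ c k`; then `w = ∑ (c k / S) • (w + r k)` is almost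
a convex combination when `S` is large. Dirichlet's theorem provides natural numbers `y k` with sum
`q` approximating the numbers `q * c k / S` so well that `(1 + q) • w - ∑ y k • (w + r k)` still
lies in the cone, although it is lower than the lowest lattice point `w`. The approximation has to
be finer than each of the approximated coefficients, so only those above some threshold are
approximated, and the threshold is placed in a gap of the sequence of coefficients that is wide
enough for the others to be negligible. The size of these gaps gives `∑ c k < n ^ (6 n! - 2)`.

Finally, a facet through `w` contains the points `w + g j` for `n - 1` linearly independent edge
vectors `g j`, so its integer distance to the origin is at most
`|det (w, g)| = |∑ c k * det (r k, g)| ≤ (∑ c k) * det St_w`.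
-/

namespace KleinSail

/-! ### Simultaneous approximation with a controlled denominator -/

theorem exists_simultaneous_approx {ι : Type*} (I : Finset ι) (α : ι → ℝ) {M : ℕ} (hM : 0 < M) :
    ∃ q : ℕ, 0 < q ∧ q ≤ M ^ I.card ∧
      ∃ z : ι → ℤ, ∀ i ∈ I, |(q : ℝ) * α i - z i| < 1 / M := by
  classical
  have hM' : (0 : ℝ) < M := by exact_mod_cast hM
  let box : Fin (M ^ I.card + 1) → (I → Fin M) := fun j i =>
    ⟨⌊(M : ℝ) * Int.fract ((j : ℕ) * α i)⌋₊, by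
      rw [Nat.floor_lt (by positivity)]
      nlinarith [Int.fract_lt_one (((j : ℕ) : ℝ) * α i)]⟩
  obtain ⟨j, k, hjk, hbox⟩ : ∃ j k : Fin (M ^ I.card + 1), (j : ℕ) < k ∧ box j = box k := by
    obtain ⟨j, k, hjk, h⟩ := Fintype.exists_ne_map_eq_of_card_lt box (by simp)
    rcases hjk.lt_or_gt with hlt | hgt
    · exact ⟨j, k, hlt, h⟩
    · exact ⟨k, j, hgt, h.symm⟩
  refine ⟨k - j, by omega, by omega,
    fun i => ⌊((k : ℕ) : ℝ) * α i⌋ - ⌊((j : ℕ) : ℝ) * α i⌋, fun i hi => ?_⟩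
  set a := Int.fract (((j : ℕ) : ℝ) * α i) with ha
  set c := Int.fract (((k : ℕ) : ℝ) * α i) with hc
  have hfloor : ⌊(M : ℝ) * a⌋₊ = ⌊(M : ℝ) * c⌋₊ := congrArg Fin.val (congrFun hbox ⟨i, hi⟩)
  have hfract : (((k - j : ℕ) : ℝ)) * α i -
      ((⌊((k : ℕ) : ℝ) * α i⌋ - ⌊((j : ℕ) : ℝ) * α i⌋ : ℤ) : ℝ) = c - a := by
    rw [ha, hc, Int.fract, Int.fract, Nat.cast_sub hjk.le]
    push_cast
    ring
  have ha₁ := Nat.floor_le (a := (M : ℝ) * a) (by positivity)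
  have ha₂ := Nat.lt_floor_add_one ((M : ℝ) * a)
  have hc₁ := Nat.floor_le (a := (M : ℝ) * c) (by positivity)
  have hc₂ := Nat.lt_floor_add_one ((M : ℝ) * c)
  rw [hfloor] at ha₁ ha₂
  have habs : |(M : ℝ) * (c - a)| < 1 := abs_lt.2 ⟨by linarith, by linarith⟩
  rwa [hfract, lt_div_iff₀' hM', ← abs_of_pos hM', ← abs_mul]

theorem exists_simultaneous_nat_approx {ι : Type*} {I : Finset ι} {α : ι → ℝ}
    (hα : ∀ i ∈ I, 0 ≤ α i) {M : ℕ} (hM : 0 < M) :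
    ∃ q : ℕ, 0 < q ∧ q ≤ M ^ I.card ∧
      ∃ y : ι → ℕ, ∀ i ∈ I, |(q : ℝ) * α i - y i| < 1 / M := by
  obtain ⟨q, hq, hqM, z, hz⟩ := exists_simultaneous_approx I α hM
  refine ⟨q, hq, hqM, fun i => (z i).toNat, fun i hi => ?_⟩
  have hM₁ : 1 / (M : ℝ) ≤ 1 := by rw [one_div]; exact Nat.cast_inv_le_one M
  have hqα : 0 ≤ (q : ℝ) * α i := mul_nonneg q.cast_nonneg (hα i hi)
  have hz₁ : (-1 : ℝ) < z i := by linarith [(abs_lt.1 (hz i hi)).2]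
  have hz₀ : 0 ≤ z i := Int.add_one_le_iff.2 (by exact_mod_cast hz₁)
  have hcast : (((z i).toNat : ℕ) : ℝ) = z i := by exact_mod_cast Int.toNat_of_nonneg hz₀
  rw [hcast]
  exact hz i hi

theorem exists_nat_approx_of_sum_le_one {ι : Type*} {I : Finset ι} {α : ι → ℝ} {M : ℕ}
    (hI : I.Nonempty) (hM : 2 * I.card ≤ M) (hα : ∀ i ∈ I, 0 ≤ α i) (hle : ∑ i ∈ I, α i ≤ 1)
    (hge : 1 - ∑ i ∈ I, α i ≤ 1 / (2 * (M : ℝ) ^ I.card)) :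
    ∃ y : ι → ℕ, 0 < ∑ i ∈ I, y i ∧ ∑ i ∈ I, y i ≤ M ^ I.card ∧
      ∀ i ∈ I, |((∑ i ∈ I, y i : ℕ) : ℝ) * α i - y i| < 1 / M := by
  have hM₀ : 0 < M := by have := hI.card_pos; omega
  obtain ⟨q, hq, hqM, y, hy⟩ := exists_simultaneous_nat_approx hα hM₀
  have hround : |∑ i ∈ I, ((q : ℝ) * α i - y i)| < 1 / 2 := by
    calc |∑ i ∈ I, ((q : ℝ) * α i - y i)| ≤ ∑ i ∈ I, |(q : ℝ) * α i - y i| :=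
          Finset.abs_sum_le_sum_abs _ _
      _ < ∑ _i ∈ I, 1 / (M : ℝ) := Finset.sum_lt_sum_of_nonempty hI hy
      _ = I.card / M := by rw [Finset.sum_const, nsmul_eq_mul, mul_one_div]
      _ ≤ 1 / 2 := by
        rw [div_le_div_iff₀ (by exact_mod_cast hM₀) two_pos]
        exact_mod_cast (by omega : I.card * 2 ≤ 1 * M)
  have hdefect : q * (1 - ∑ i ∈ I, α i) ≤ 1 / 2 := by
    have hpow : (M : ℝ) ^ I.card ≠ 0 := by exact_mod_cast (pow_pos hM₀ _).ne'
    calc q * (1 - ∑ i ∈ I, α i) ≤ (M : ℝ) ^ I.card * (1 / (2 * (M : ℝ) ^ I.card)) :=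
          mul_le_mul (by exact_mod_cast hqM) hge (by linarith) (by positivity)
      _ = 1 / 2 := by rw [mul_one_div, div_mul_cancel_right₀ hpow, one_div]
  have hsum : ∑ i ∈ I, y i = q := by
    rw [Finset.sum_sub_distrib, ← Finset.mul_sum] at hround
    have hround := abs_lt.1 hround
    have hdefect₀ : 0 ≤ q * (1 - ∑ i ∈ I, α i) := mul_nonneg q.cast_nonneg (by linarith)
    have hdist : |((∑ i ∈ I, y i : ℕ) : ℝ) - q| < 1 := by
      push_cast
      exact abs_lt.2 ⟨by linarith, by linarith⟩
    have hdist : |((∑ i ∈ I, y i : ℕ) : ℤ) - q| < 1 := by exact_mod_cast hdist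
    rw [Int.abs_lt_one_iff] at hdist
    omega
  exact ⟨y, hsum.symm ▸ hq, hsum.symm ▸ hqM, by rwa [hsum]⟩

/-- The scales between which the coefficients of a point of a simplex are compared. The recursion
is the one that makes Dirichlet's theorem with error `1 / scale n j`, applied to `j + 1` numbers,
produce a denominator of size at most `scale n (j + 1) / (2 * n)`. -/
def scale (n : ℕ) : ℕ → ℕ
  | 0 => n + 1
  | j + 1 => 2 * n * scale n j ^ (j + 1)

theorem scale_pos {n : ℕ} (hn : 0 < n) (j : ℕ) : 0 < scale n j := by
  induction j with
  | zero => exact n.succ_pos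
  | succ j ih => rw [scale]; positivity

theorem scale_monotone {n : ℕ} (hn : 0 < n) : Monotone (scale n) :=
  monotone_nat_of_le_succ fun j => calc
    scale n j = 1 * scale n j ^ 1 := by rw [one_mul, pow_one]
    _ ≤ 2 * n * scale n j ^ (j + 1) :=
      Nat.mul_le_mul (by omega) (Nat.pow_le_pow_right (scale_pos hn j) (by omega))

theorem scale_le_scale {k n : ℕ} (hkn : k ≤ n) (j : ℕ) : scale k j ≤ scale n j := by
  induction j with
  | zero => exact Nat.succ_le_succ hkn
  | succ j ih => exact Nat.mul_le_mul (Nat.mul_le_mul_left 2 hkn) (Nat.pow_le_pow_left ih _)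

theorem two_mul_succ_le_scale {n j : ℕ} (hj : j < n) : 2 * (j + 1) ≤ scale n j := by
  cases j with
  | zero => rw [scale]; omega
  | succ j => calc
      2 * (j + 1 + 1) ≤ 2 * n * 1 := by omega
      _ ≤ 2 * n * scale n j ^ (j + 1) :=
        Nat.mul_le_mul_left _ (Nat.one_le_pow _ _ (scale_pos (by omega) j))

theorem scale_succ_le_pow {n : ℕ} (hn : 2 ≤ n) (j : ℕ) :
    scale n (j + 1) ≤ n ^ (6 * (j + 1)! - 2) := by
  induction j with
  | zero => calc
      scale n 1 = 2 * n * (n + 1) := by simp only [scale, zero_add, pow_one]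
      _ ≤ n * n * (n * n) := Nat.mul_le_mul (by nlinarith) (by nlinarith)
      _ = n ^ (6 * (0 + 1)! - 2) := by simp only [zero_add, Nat.factorial_one]; ring
  | succ j ih =>
    have hexp : 2 + (6 * (j + 1)! - 2) * (j + 2) ≤ 6 * (j + 2)! - 2 := by
      obtain ⟨t, ht⟩ := Nat.exists_eq_add_of_le' (Nat.factorial_pos (j + 1))
      rw [Nat.factorial_succ (j + 1), ht, show 6 * (t + 1) - 2 = 6 * t + 4 by omega]
      refine Nat.le_sub_of_add_le ?_
      nlinarith
    calc scale n (j + 2) = 2 * n * scale n (j + 1) ^ (j + 2) := rfl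
      _ ≤ n ^ 2 * (n ^ (6 * (j + 1)! - 2)) ^ (j + 2) :=
        Nat.mul_le_mul (by nlinarith) (Nat.pow_le_pow_left ih _)
      _ = n ^ (2 + (6 * (j + 1)! - 2) * (j + 2)) := by rw [← pow_mul, ← pow_add]
      _ ≤ n ^ (6 * (j + 2)! - 2) := Nat.pow_le_pow_right (by omega) hexp

theorem exists_eq_succ_of_monotone {ι : Type*} {I : ℕ → Finset ι} (hI : Monotone I)
    (h₀ : (I 0).Nonempty) {n : ℕ} (hn : (I n).card ≤ n) :
    ∃ j < n, I j = I (j + 1) ∧ (I j).card = j + 1 := by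
  induction n with
  | zero => exact absurd h₀.card_pos hn.not_gt
  | succ n ih =>
    by_cases hcard : (I n).card ≤ n
    · obtain ⟨j, hj, h⟩ := ih hcard
      exact ⟨j, hj.trans n.lt_succ_self, h⟩
    · have hsub : I n ⊆ I (n + 1) := hI n.le_succ
      exact ⟨n, n.lt_succ_self, Finset.eq_of_subset_of_card_le hsub (by omega),
        by have := Finset.card_le_card hsub; omega⟩

theorem exists_scale_gap {ι : Type*} [Fintype ι] [Nonempty ι] {α : ι → ℝ}
    (hα : 1 - 1 / (scale (Fintype.card ι) (Fintype.card ι) : ℝ) < ∑ i, α i) :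
    ∃ j < Fintype.card ι, ∃ I : Finset ι, I.card = j + 1 ∧
      (∀ i ∈ I, 1 / (scale (Fintype.card ι) j : ℝ) ≤ α i) ∧
      ∀ i ∉ I, α i ≤ 1 / (scale (Fintype.card ι) (j + 1) : ℝ) := by
  set n := Fintype.card ι with hn
  have hn₀ : 0 < n := Fintype.card_pos
  have hscale : ∀ j, (0 : ℝ) < scale n j := fun j => by exact_mod_cast scale_pos hn₀ j
  let I : ℕ → Finset ι := fun j => {i | 1 / (scale n j : ℝ) ≤ α i}
  have hmono : Monotone I := fun j k hjk i hi => by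
    simp only [I, Finset.mem_filter, Finset.mem_univ, true_and] at hi ⊢
    exact (one_div_le_one_div_of_le (hscale j) (by exact_mod_cast scale_monotone hn₀ hjk)).trans hi
  have hI₀ : (I 0).Nonempty := by
    have haverage : ∑ _i : ι, 1 / ((n : ℝ) + 1) ≤ ∑ i, α i := calc
      ∑ _i : ι, 1 / ((n : ℝ) + 1) = 1 - 1 / (scale n 0 : ℝ) := by
        rw [Finset.sum_const, Finset.card_univ, ← hn, nsmul_eq_mul, scale]
        push_cast
        field_simp
        ring
      _ ≤ 1 - 1 / (scale n n : ℝ) := sub_le_sub_left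
        (one_div_le_one_div_of_le (hscale 0) (by exact_mod_cast scale_monotone hn₀ n.zero_le)) 1
      _ ≤ ∑ i, α i := hα.le
    obtain ⟨i, -, hi⟩ := Finset.exists_le_of_sum_le Finset.univ_nonempty haverage
    exact ⟨i, by simpa [I, scale] using hi⟩
  obtain ⟨j, hj, heq, hcard⟩ :=
    exists_eq_succ_of_monotone hmono hI₀ (n := n) (Finset.card_le_univ _)
  refine ⟨j, hj, I j, hcard, fun i hi => by simpa [I] using hi, fun i hi => ?_⟩
  rw [heq] at hi
  exact le_of_lt (by simpa [I] using hi)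

theorem exists_concentration {ι : Type*} [Fintype ι] [Nonempty ι] {α : ι → ℝ}
    (hα : 1 - 1 / (scale (Fintype.card ι) (Fintype.card ι) : ℝ) < ∑ i, α i) :
    ∃ I : Finset ι, I.Nonempty ∧ ∃ M : ℕ, 2 * I.card ≤ M ∧ (∀ i ∈ I, 1 / (M : ℝ) ≤ α i) ∧
      1 - ∑ i ∈ I, α i ≤ 1 / (2 * (M : ℝ) ^ I.card) := by
  classical
  obtain ⟨j, hj, I, hcard, hlow, hhigh⟩ := exists_scale_gap hα
  set n := Fintype.card ι with hn
  have hn₀ : 0 < n := Fintype.card_pos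
  have hM : (0 : ℝ) < scale n j := by exact_mod_cast scale_pos hn₀ j
  have hM' : (0 : ℝ) < scale n (j + 1) := by exact_mod_cast scale_pos hn₀ (j + 1)
  have hcompl : ∑ i ∈ Iᶜ, α i ≤ (n - 1) * (1 / (scale n (j + 1) : ℝ)) := calc
    ∑ i ∈ Iᶜ, α i ≤ Iᶜ.card • (1 / (scale n (j + 1) : ℝ)) :=
      Finset.sum_le_card_nsmul _ _ _ fun i hi => hhigh i (Finset.mem_compl.1 hi)
    _ ≤ (n - 1) * (1 / (scale n (j + 1) : ℝ)) := by
      rw [nsmul_eq_mul, Finset.card_compl, hcard, ← hn, Nat.cast_sub (by omega)]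
      push_cast
      gcongr
      linarith [j.cast_nonneg (α := ℝ)]
  have hlast : 1 / (scale n n : ℝ) ≤ 1 / (scale n (j + 1) : ℝ) :=
    one_div_le_one_div_of_le hM' (by exact_mod_cast scale_monotone hn₀ hj)
  refine ⟨I, Finset.card_pos.1 (by omega), scale n j,
    hcard ▸ two_mul_succ_le_scale hj, hlow, ?_⟩
  calc 1 - ∑ i ∈ I, α i ≤ n * (1 / (scale n (j + 1) : ℝ)) := by
        linarith [Finset.sum_add_sum_compl I α]
    _ = 1 / (2 * (scale n j : ℝ) ^ I.card) := by
        rw [hcard, scale]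
        push_cast
        field_simp

theorem exists_nat_le_one_add_sum_mul {ι : Type*} [Fintype ι] [Nonempty ι] {α : ι → ℝ}
    (h₀ : ∀ i, 0 ≤ α i) (h₁ : ∑ i, α i ≤ 1)
    (hα : 1 - 1 / (scale (Fintype.card ι) (Fintype.card ι) : ℝ) < ∑ i, α i) :
    ∃ y : ι → ℕ, 0 < ∑ i, y i ∧ (∀ i, (y i : ℝ) ≤ (1 + (∑ i, y i : ℕ)) * α i) ∧
      ∃ i, (y i : ℝ) < (1 + (∑ i, y i : ℕ)) * α i := by
  classical
  obtain ⟨I, hI, M, hM, hlow, hconc⟩ := exists_concentration hα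
  have hsub : ∑ i ∈ I, α i ≤ ∑ i, α i :=
    Finset.sum_le_univ_sum_of_nonneg h₀
  obtain ⟨y, hy₀, hyM, hy⟩ :=
    exists_nat_approx_of_sum_le_one hI hM (fun i _ => h₀ i) (hsub.trans h₁) hconc
  have hsum : ∑ i, (if i ∈ I then y i else 0) = ∑ i ∈ I, y i := by
    rw [Finset.sum_ite_mem, Finset.univ_inter]
  refine ⟨fun i => if i ∈ I then y i else 0, by rwa [hsum], ?_, ?_⟩ <;> rw [hsum] <;>
    set q := ∑ i ∈ I, y i
  · intro i
    beta_reduce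
    split_ifs with hi
    · linarith [(abs_lt.1 (hy i hi)).1, hlow i hi]
    · rw [Nat.cast_zero]
      exact mul_nonneg (by positivity) (h₀ i)
  · have hM₂ : (2 : ℝ) ≤ (M : ℝ) ^ I.card := by
      have hM₂ : 2 ≤ M := by have := hI.card_pos; omega
      exact_mod_cast hM₂.trans (Nat.le_self_pow hI.card_pos.ne' M)
    have hq : (q : ℝ) ≤ (M : ℝ) ^ I.card := by exact_mod_cast hyM
    have hdefect : (1 + q) * (1 - ∑ i, α i) < 1 := calc
      (1 + q) * (1 - ∑ i, α i) ≤ (1 + (M : ℝ) ^ I.card) * (1 / (2 * (M : ℝ) ^ I.card)) :=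
        mul_le_mul (by linarith) (by linarith) (by linarith) (by positivity)
      _ < 1 := by rw [mul_one_div, div_lt_one (by positivity)]; linarith
    have hlt : ∑ i, ((if i ∈ I then y i else 0 : ℕ) : ℝ) < ∑ i, (1 + q) * α i := by
      rw [← Finset.mul_sum, ← Nat.cast_sum, hsum]
      linarith
    obtain ⟨i, -, hi⟩ := Finset.exists_lt_of_sum_lt hlt
    exact ⟨i, hi⟩

/-! ### Finitely generated monoids and cones -/

theorem partiallyWellOrderedOn_sub_mem {M ι : Type*} [AddCommGroup M] [Finite ι] {a : ι → ℝ}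
    (ha : ∀ i, 0 < a i) (L : ι → M →+ ℝ) :
    {z : M | ∀ i, 0 < a i + L i z}.PartiallyWellOrderedOn
      fun x y => y - x ∈ {z : M | ∀ i, 0 < a i + L i z} := by
  refine Set.partiallyWellOrderedOn_iff_exists_lt.2 fun u hu => ?_
  obtain ⟨j, k, hjk, hle⟩ := wellQuasiOrdered_le (α := ι → ℕ)
    fun j i => ⌊(a i + L i (u j)) / a i⌋₊
  refine ⟨j, k, hjk, fun i => ?_⟩
  have hle : (⌊(a i + L i (u j)) / a i⌋₊ : ℝ) ≤ ⌊(a i + L i (u k)) / a i⌋₊ := by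
    exact_mod_cast hle i
  have hlt : (a i + L i (u j)) / a i < (a i + L i (u k)) / a i + 1 := by
    linarith [Nat.lt_floor_add_one ((a i + L i (u j)) / a i),
      Nat.floor_le (div_nonneg (hu k i).le (ha i).le)]
  rw [div_add_one (ha i).ne', div_lt_div_iff_of_pos_right (ha i)] at hlt
  rw [map_sub]
  linarith

theorem exists_finite_subset_closure {M : Type*} [AddCommGroup M] {Q : Set M}
    (hQ : Q.PartiallyWellOrderedOn fun x y => y - x ∈ Q) {f : M →+ ℝ}
    (hf : ∀ z ∈ Q, z ≠ 0 → 0 < f z) :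
    ∃ G ⊆ Q \ {0}, G.Finite ∧ Q ⊆ AddSubmonoid.closure G := by
  let G : Set M := {z ∈ Q \ {0} | ∀ x ∈ Q \ {0}, z - x ∈ Q → x = z}
  have hGQ : G ⊆ Q \ {0} := fun z hz => hz.1
  have hantichain : IsAntichain (fun x y => y - x ∈ Q) G := fun x hx y hy hxy h =>
    hxy (hy.2 x hx.1 h)
  have hf₀ : ∀ z ∈ Q, 0 ≤ f z := fun z hz => by
    rcases eq_or_ne z 0 with rfl | hz₀
    · rw [map_zero]
    · exact (hf z hz hz₀).le
  have hwf : Q.WellFoundedOn fun x y => f x < f y := by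
    have himage : (f '' Q).IsPWO := hQ.image_of_monotone_on fun x _ y _ h => by
      simpa only [map_sub, sub_nonneg] using hf₀ _ h
    exact Set.wellFoundedOn_image.1 himage.isWF
  refine ⟨G, hGQ, hantichain.finite_of_partiallyWellOrderedOn
    (hQ.mono (hGQ.trans Set.sdiff_subset)), fun z hz => hwf.induction hz fun z hz ih => ?_⟩
  rcases eq_or_ne z 0 with rfl | hz₀
  · exact zero_mem _
  by_cases hzG : z ∈ G
  · exact AddSubmonoid.subset_closure hzG
  obtain ⟨x, ⟨hx, hx₀⟩, hzx, hne⟩ : ∃ x ∈ Q \ {0}, z - x ∈ Q ∧ x ≠ z := by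
    by_contra! h
    exact hzG ⟨⟨hz, hz₀⟩, h⟩
  have hfx := hf x hx hx₀
  have hfzx := hf (z - x) hzx (sub_ne_zero.2 hne.symm)
  rw [map_sub] at hfzx
  rw [← sub_add_cancel z x]
  exact add_mem (ih _ hzx (by rw [map_sub]; linarith)) (ih x hx (by linarith))

section Cones

variable {E : Type*} [AddCommGroup E] [Module ℝ E]

theorem mem_hull_finset {s : Finset E} {x : E} :
    x ∈ PointedCone.hull ℝ (s : Set E) ↔
      ∃ c : E → ℝ, (∀ y ∈ s, 0 ≤ c y) ∧ ∑ y ∈ s, c y • y = x := by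
  classical
  constructor
  · intro hx
    obtain ⟨c, -, hc⟩ := Submodule.mem_span_finset.1 hx
    exact ⟨fun y => c y, fun y _ => (c y).2, hc⟩
  · rintro ⟨c, hc, rfl⟩
    exact sum_mem fun y hy => (PointedCone.hull ℝ _).smul_mem (hc y hy)
      (PointedCone.subset_hull hy)

theorem exists_mem_hull_erase [DecidableEq E] {s : Finset E}
    (hs : ¬LinearIndepOn ℝ id (s : Set E)) {x : E} (hx : x ∈ PointedCone.hull ℝ (s : Set E)) :
    ∃ m ∈ s, x ∈ PointedCone.hull ℝ (s.erase m : Set E) := by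
  obtain ⟨c, hc, rfl⟩ := mem_hull_finset.1 hx
  obtain ⟨g, hg, x₀, hx₀, hgx₀⟩ :
      ∃ g : E → ℝ, ∑ y ∈ s, g y • y = 0 ∧ ∃ y ∈ s, 0 < g y := by
    obtain ⟨g, hg, y, hy, hgy⟩ := not_linearIndepOn_finset_iff.1 hs
    rcases hgy.lt_or_gt with h | h
    · refine ⟨-g, ?_, y, hy, neg_pos.2 h⟩
      simpa only [Pi.neg_apply, neg_smul, Finset.sum_neg_distrib, neg_eq_zero, id] using hg
    · exact ⟨g, hg, y, hy, h⟩
  -- Subtract the largest multiple of the relation `g` that keeps all coefficients nonnegative.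
  obtain ⟨m, hm, hmin⟩ := (s.filter fun y => 0 < g y).exists_min_image (fun y => c y / g y)
    ⟨x₀, Finset.mem_filter.2 ⟨hx₀, hgx₀⟩⟩
  obtain ⟨hms, hgm⟩ := Finset.mem_filter.1 hm
  set ρ := c m / g m with hρ
  refine ⟨m, hms, mem_hull_finset.2 ⟨fun y => c y - ρ * g y, fun y hy => ?_, ?_⟩⟩
  · have hys := Finset.mem_of_mem_erase hy
    rcases lt_or_ge 0 (g y) with hgy | hgy
    · have hle := hmin y (Finset.mem_filter.2 ⟨hys, hgy⟩)
      rw [le_div_iff₀ hgy] at hle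
      linarith
    · nlinarith [hc y hys, div_nonneg (hc m hms) hgm.le]
  · have hzero : (c m - ρ * g m) • m = 0 := by
      rw [hρ, div_mul_cancel₀ _ hgm.ne', sub_self, zero_smul]
    rw [Finset.sum_erase s (f := fun y => (c y - ρ * g y) • y) hzero]
    simp only [sub_smul, mul_smul, Finset.sum_sub_distrib, ← Finset.smul_sum, hg, smul_zero,
      sub_zero]

theorem exists_linearIndepOn_mem_hull {Y : Set E} {x : E} (hx : x ∈ PointedCone.hull ℝ Y) :
    ∃ t : Finset E, (t : Set E) ⊆ Y ∧ LinearIndepOn ℝ id (t : Set E) ∧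
      x ∈ PointedCone.hull ℝ (t : Set E) := by
  classical
  obtain ⟨s, hsY, hxs⟩ := Submodule.mem_span_finite_of_mem_span hx
  induction s using Finset.strongInduction with
  | H s ih =>
    by_cases hs : LinearIndepOn ℝ id (s : Set E)
    · exact ⟨s, hsY, hs, hxs⟩
    · obtain ⟨m, hm, hxm⟩ := exists_mem_hull_erase hs hxs
      exact ih _ (Finset.erase_ssubset hm)
        ((Finset.coe_subset.2 (Finset.erase_subset m s)).trans hsY) hxm

theorem exists_irredundant_hull_eq {X : Set E} (hX : X.Finite) :
    ∃ Y ⊆ X, PointedCone.hull ℝ Y = PointedCone.hull ℝ X ∧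
      ∀ y ∈ Y, y ∉ PointedCone.hull ℝ (Y \ {y}) := by
  have hfinite : {Y | Y ⊆ X ∧ PointedCone.hull ℝ Y = PointedCone.hull ℝ X}.Finite :=
    hX.finite_subsets.subset fun Y hY => hY.1
  obtain ⟨Y, ⟨hYX, hY⟩, hmin⟩ := hfinite.exists_minimal ⟨X, subset_rfl, rfl⟩
  refine ⟨Y, hYX, hY, fun y hy hred => ?_⟩
  have hspan : PointedCone.hull ℝ (insert y (Y \ {y})) = PointedCone.hull ℝ (Y \ {y}) :=
    Submodule.span_insert_eq_span hred
  rw [Set.insert_sdiff_singleton, Set.insert_eq_of_mem hy, hY] at hspan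
  exact (hmin ⟨Set.sdiff_subset.trans hYX, hspan.symm⟩ Set.sdiff_subset hy).2 rfl

theorem exists_exposing_functional [TopologicalSpace E] [IsTopologicalAddGroup E]
    [ContinuousSMul ℝ E] [LocallyConvexSpace ℝ E] [T2Space E] {Y : Set E} (hY : Y.Finite)
    {f : StrongDual ℝ E} (hf : ∀ y ∈ Y, 0 < f y) {g : E} (hg : g ∈ Y)
    (hirr : g ∉ PointedCone.hull ℝ (Y \ {g})) :
    ∃ h : StrongDual ℝ E, h g = 0 ∧ ∀ y ∈ Y, y ≠ g → h y < 0 := by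
  have hsub : convexHull ℝ (Y \ {g}) ⊆ (PointedCone.hull ℝ (Y \ {g}) : Set E) :=
    convexHull_min PointedCone.subset_hull (PointedCone.convex _)
  have hfpos : convexHull ℝ (Y \ {g}) ⊆ {x | 0 < f x} :=
    convexHull_min (fun y hy => hf y hy.1) (convex_halfSpace_gt f.toLinearMap.isLinear 0)
  have hdisj : Disjoint (convexHull ℝ (Y \ {g})) (Submodule.span ℝ {g} : Set E) := by
    refine Set.disjoint_left.2 fun x hx hxg => hirr ?_
    obtain ⟨t, rfl⟩ := Submodule.mem_span_singleton.1 hxg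
    have hft : 0 < f (t • g) := hfpos hx
    rw [map_smul, smul_eq_mul] at hft
    have ht : 0 < t := pos_of_mul_pos_left hft (hf g hg).le
    simpa only [inv_smul_smul₀ ht.ne'] using
      (PointedCone.hull ℝ (Y \ {g})).smul_mem (inv_pos.2 ht).le (hsub hx)
  obtain ⟨h, u, c, hu, huc, hc⟩ := geometric_hahn_banach_compact_closed (convex_convexHull ℝ _)
    ((hY.subset Set.sdiff_subset).isCompact_convexHull (𝕜 := ℝ)) (Submodule.span ℝ {g}).convex
    (Submodule.closed_of_finiteDimensional (Submodule.span ℝ {g})) hdisj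
  have hg₀ : h g = 0 := by
    by_contra hne
    have hlt := hc ((c / h g) • g)
      (Submodule.smul_mem _ _ (Submodule.mem_span_singleton_self g))
    rw [map_smul, smul_eq_mul, div_mul_cancel₀ _ hne] at hlt
    exact hlt.false
  have hc₀ : c < 0 := by simpa only [map_zero] using hc 0 (Submodule.zero_mem _)
  exact ⟨h, hg₀, fun y hy hyg => (hu y (subset_convexHull ℝ _ ⟨hy, hyg⟩)).trans (huc.trans hc₀)⟩

end Cones

theorem apply_nonpos_of_mem_hull {E : Type*} [AddCommGroup E] [Module ℝ E] {Y : Set E}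
    {l : E →ₗ[ℝ] ℝ} (hl : ∀ y ∈ Y, l y ≤ 0) {x : E} (hx : x ∈ PointedCone.hull ℝ Y) :
    l x ≤ 0 := by
  obtain ⟨c, hc, hc₀, rfl⟩ := PointedCone.mem_hull_set.1 hx
  rw [Finsupp.sum, map_sum]
  refine Finset.sum_nonpos fun y hy => ?_
  rw [map_smul, smul_eq_mul]
  exact mul_nonpos_of_nonneg_of_nonpos (hc₀ y) (hl y (hc hy))

theorem subset_frontier_of_isExposed {E : Type*} [NormedAddCommGroup E] [NormedSpace ℝ E]
    {K F : Set E} (hF : IsExposed ℝ K F)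
    (hdim : Module.finrank ℝ (affineSpan ℝ F).direction ≠ Module.finrank ℝ E) :
    F ⊆ frontier K := by
  refine fun x hx => ⟨subset_closure (hF.subset hx), fun hint => hdim ?_⟩
  obtain ⟨l, rfl⟩ := hF ⟨x, hx⟩
  have hmax : IsLocalMax l x :=
    Filter.eventually_of_mem (mem_interior_iff_mem_nhds.1 hint) fun y hy => hx.2 y hy
  have hl : l = 0 := hmax.hasFDerivAt_eq_zero l.hasFDerivAt
  have hsub : interior K ⊆ {y ∈ K | ∀ z ∈ K, l z ≤ l y} := fun y hy =>
    ⟨interior_subset hy, fun z _ => by simp only [hl, zero_apply, le_refl]⟩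
  have htop : affineSpan ℝ {y ∈ K | ∀ z ∈ K, l z ≤ l y} = ⊤ :=
    top_unique ((isOpen_interior.affineSpan_eq_top ⟨x, hint⟩).ge.trans (affineSpan_mono ℝ hsub))
  rw [htop, AffineSubspace.direction_top, finrank_top]

theorem exists_lt_of_isExposed_singleton {E : Type*} [NormedAddCommGroup E] [NormedSpace ℝ E]
    {S : Set E} {v : E} (hv : IsExposed ℝ (convexHull ℝ S) {v}) :
    v ∈ S ∧ ∃ f : StrongDual ℝ E, ∀ x ∈ S, x ≠ v → f v < f x := by
  refine ⟨extremePoints_convexHull_subset (isExtreme_singleton.1 hv.isExtreme), ?_⟩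
  obtain ⟨l, hl⟩ := hv (Set.singleton_nonempty v)
  have hmax : v ∈ l.toExposed (convexHull ℝ S) := hl.le (Set.mem_singleton v)
  refine ⟨-l, fun x hx hxv => neg_lt_neg (lt_of_not_ge fun hle => hxv ?_)⟩
  have hx : x ∈ l.toExposed (convexHull ℝ S) :=
    ⟨subset_convexHull ℝ S hx, fun y hy => (hmax.2 y hy).trans hle⟩
  exact Set.mem_singleton_iff.1 (hl.ge hx)

/-- The vectors of `Y` describe the set `K` near its point `w`: they lead from `w` to points of
`K`, and `K` lies in the cone with vertex `w` that they generate. -/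
structure IsLocalFrame {E : Type*} [AddCommGroup E] [Module ℝ E] (K : Set E) (w : E) (Y : Set E) :
    Prop where
  mem : w ∈ K
  add_mem : ∀ y ∈ Y, w + y ∈ K
  sub_mem_hull : ∀ x ∈ K, x - w ∈ PointedCone.hull ℝ Y

theorem isLocalFrame_convexHull {E : Type*} [AddCommGroup E] [Module ℝ E] {S Y : Set E} {w : E}
    (hw : w ∈ S) (hadd : ∀ y ∈ Y, w + y ∈ S) (hsub : ∀ x ∈ S, x - w ∈ PointedCone.hull ℝ Y) :
    IsLocalFrame (convexHull ℝ S) w Y where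
  mem := subset_convexHull ℝ S hw
  add_mem y hy := subset_convexHull ℝ S (hadd y hy)
  sub_mem_hull := by
    have hconvex : Convex ℝ ((fun x => -w + x) ⁻¹' (PointedCone.hull ℝ Y : Set E)) :=
      (PointedCone.convex (PointedCone.hull ℝ Y)).translate_preimage_right (-w)
    have hsubset : S ⊆ (fun x => -w + x) ⁻¹' (PointedCone.hull ℝ Y : Set E) := fun x hx => by
      simpa only [Set.mem_preimage, SetLike.mem_coe, neg_add_eq_sub] using hsub x hx
    intro x hx
    simpa only [Set.mem_preimage, SetLike.mem_coe, neg_add_eq_sub] using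
      convexHull_min hsubset hconvex hx

namespace IsLocalFrame

variable {E : Type*} [AddCommGroup E] [Module ℝ E] [TopologicalSpace E] {K Y : Set E} {w : E}
  {l : StrongDual ℝ E}

theorem mem_toExposed (hY : IsLocalFrame K w Y) (hl : ∀ y ∈ Y, l y ≤ 0) : w ∈ l.toExposed K :=
  ⟨hY.mem, fun x hx => by
    have hle := apply_nonpos_of_mem_hull (l := l.toLinearMap) hl (hY.sub_mem_hull x hx)
    simpa only [ContinuousLinearMap.coe_coe, map_sub, sub_nonpos] using hle⟩

theorem apply_nonpos (hY : IsLocalFrame K w Y) (hw : w ∈ l.toExposed K) {y : E} (hy : y ∈ Y) :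
    l y ≤ 0 := by
  simpa only [map_add, add_le_iff_nonpos_right] using hw.2 _ (hY.add_mem y hy)

theorem add_mem_toExposed (hY : IsLocalFrame K w Y) (hw : w ∈ l.toExposed K) {y : E} (hy : y ∈ Y)
    (hly : l y = 0) : w + y ∈ l.toExposed K :=
  ⟨hY.add_mem y hy, fun x hx => by simpa only [map_add, hly, add_zero] using hw.2 x hx⟩

theorem sub_mem_hull_of_mem_toExposed (hY : IsLocalFrame K w Y) (hw : w ∈ l.toExposed K) {x : E}
    (hx : x ∈ l.toExposed K) : x - w ∈ PointedCone.hull ℝ {y ∈ Y | l y = 0} := by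
  obtain ⟨c, hc, hc₀, hcx⟩ := PointedCone.mem_hull_set.1 (hY.sub_mem_hull x hx.1)
  have hsum : ∑ y ∈ c.support, c y * l y = 0 := by
    have hlx : l x = l w := le_antisymm (hw.2 x hx.1) (hx.2 w hY.mem)
    rw [← sub_eq_zero, ← map_sub, ← hcx, Finsupp.sum, map_sum] at hlx
    simpa only [map_smul, smul_eq_mul] using hlx
  have hterm : ∀ y ∈ c.support, c y * l y ≤ 0 := fun y hy =>
    mul_nonpos_of_nonneg_of_nonpos (hc₀ y) (hY.apply_nonpos hw (hc hy))
  refine PointedCone.mem_hull_set.2 ⟨c, fun y hy => ⟨hc hy, ?_⟩, hc₀, hcx⟩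
  exact (mul_eq_zero.1 ((Finset.sum_eq_zero_iff_of_nonpos hterm).1 hsum y hy)).resolve_left
    (Finsupp.mem_support_iff.1 hy)

theorem direction_affineSpan_toExposed (hY : IsLocalFrame K w Y) (hw : w ∈ l.toExposed K) :
    (affineSpan ℝ (l.toExposed K)).direction = Submodule.span ℝ {y ∈ Y | l y = 0} := by
  rw [direction_affineSpan, vectorSpan_eq_span_vsub_set_right ℝ hw]
  apply le_antisymm <;> rw [Submodule.span_le]
  · rintro _ ⟨x, hx, rfl⟩
    exact PointedCone.hull_le_span ℝ _ (hY.sub_mem_hull_of_mem_toExposed hw hx)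
  · rintro y ⟨hy, hly⟩
    exact Submodule.subset_span ⟨w + y, hY.add_mem_toExposed hw hy hly, add_sub_cancel_left w y⟩

theorem exists_linearIndependent_of_mem_toExposed [FiniteDimensional ℝ E]
    (hY : IsLocalFrame K w Y) (hw : w ∈ l.toExposed K) {m : ℕ}
    (hm : Module.finrank ℝ (affineSpan ℝ (l.toExposed K)).direction = m) :
    ∃ y : Fin m → E, (∀ j, y j ∈ Y ∧ l (y j) = 0) ∧ LinearIndependent ℝ y := by
  subst hm
  rw [hY.direction_affineSpan_toExposed hw]
  obtain ⟨y, hy, -, hli⟩ := Submodule.exists_fun_fin_finrank_span_eq ℝ {y ∈ Y | l y = 0}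
  exact ⟨y, hy, hli⟩

theorem exists_isExposed_finrank_eq_one [IsTopologicalAddGroup E] [ContinuousSMul ℝ E]
    [LocallyConvexSpace ℝ E] [T2Space E] (hY : IsLocalFrame K w Y) (hfin : Y.Finite)
    {f : StrongDual ℝ E} (hf : ∀ y ∈ Y, 0 < f y) {y : E} (hy : y ∈ Y)
    (hirr : y ∉ PointedCone.hull ℝ (Y \ {y})) :
    ∃ F, IsExposed ℝ K F ∧ w ∈ F ∧ w + y ∈ F ∧
      Module.finrank ℝ (affineSpan ℝ F).direction = 1 := by
  obtain ⟨l, hly, hl⟩ := exists_exposing_functional hfin hf hy hirr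
  have hzero : {y' ∈ Y | l y' = 0} = {y} := by
    refine Set.Subset.antisymm (fun y' hy' => ?_) (Set.singleton_subset_iff.2 ⟨hy, hly⟩)
    by_contra hne
    exact (hl y' hy'.1 hne).ne hy'.2
  have hw : w ∈ l.toExposed K := hY.mem_toExposed fun y' hy' => by
    rcases eq_or_ne y' y with rfl | hne
    · exact hly.le
    · exact (hl y' hy' hne).le
  refine ⟨l.toExposed K, ContinuousLinearMap.toExposed.isExposed, hw,
    hY.add_mem_toExposed hw hy hly, ?_⟩
  rw [hY.direction_affineSpan_toExposed hw, hzero, finrank_span_singleton]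
  rintro rfl
  exact (hf 0 hy).ne' (map_zero f)

theorem exists_mem_eq_smul_of_isExposed (hY : IsLocalFrame K w Y) {f : StrongDual ℝ E}
    (hf : ∀ y ∈ Y, 0 < f y) {F : Set E} (hF : IsExposed ℝ K F)
    (hdim : Module.finrank ℝ (affineSpan ℝ F).direction = 1) (hw : w ∈ F) {x : E} (hx : x ≠ 0)
    (hwx : w + x ∈ F) : ∃ y ∈ Y, ∃ c : ℝ, 0 < c ∧ y = c • x := by
  obtain ⟨l, rfl⟩ := hF ⟨w, hw⟩
  have hxhull := hY.sub_mem_hull_of_mem_toExposed hw hwx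
  rw [add_sub_cancel_left] at hxhull
  obtain ⟨y, hy, hly⟩ : {y ∈ Y | l y = 0}.Nonempty := by
    by_contra! hempty
    rw [hempty, PointedCone.hull, Submodule.span_empty, Submodule.mem_bot] at hxhull
    exact hx hxhull
  have hdirection := hY.direction_affineSpan_toExposed hw
  have hxdir : x ∈ Submodule.span ℝ {y ∈ Y | l y = 0} := PointedCone.hull_le_span ℝ _ hxhull
  change Module.finrank ℝ (affineSpan ℝ (l.toExposed K)).direction = 1 at hdim
  rw [hdirection] at hdim
  obtain ⟨c, hc⟩ := (finrank_eq_one_iff_of_nonzero'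
    (⟨x, hxdir⟩ : Submodule.span ℝ {y ∈ Y | l y = 0})
    fun h => hx (congrArg Subtype.val h)).1 hdim ⟨y, Submodule.subset_span ⟨hy, hly⟩⟩
  have hcx : c • x = y := congrArg Subtype.val hc
  have hfx : 0 ≤ f x := by
    have hneg := apply_nonpos_of_mem_hull (l := -f.toLinearMap)
      (fun y hy => neg_nonpos.2 (hf y hy.1).le) hxhull
    exact neg_nonpos.1 hneg
  have hcf : 0 < c * f x := by
    rw [← smul_eq_mul, ← map_smul, hcx]
    exact hf y hy
  exact ⟨y, hy, c, pos_of_mul_pos_left hcf hfx, hcx.symm⟩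

end IsLocalFrame

/-! ### Integer vectors -/

section IntegerVectors

variable {n : ℕ}

/-- The embedding `toReal` of `ℤⁿ` into `ℝⁿ` as a homomorphism of additive groups. -/
def toRealHom (n : ℕ) : (Fin n → ℤ) →+ (Fin n → ℝ) :=
  (Int.castAddHom ℝ).compLeft (Fin n)

theorem toReal_injective : Function.Injective (toReal (n := n)) :=
  Int.cast_injective.comp_left

theorem toReal_zero : toReal (0 : Fin n → ℤ) = 0 := map_zero (toRealHom n)

theorem toReal_add (x y : Fin n → ℤ) : toReal (x + y) = toReal x + toReal y :=
  map_add (toRealHom n) x y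

theorem toReal_neg (x : Fin n → ℤ) : toReal (-x) = -toReal x := map_neg (toRealHom n) x

theorem toReal_sub (x y : Fin n → ℤ) : toReal (x - y) = toReal x - toReal y :=
  map_sub (toRealHom n) x y

theorem toReal_sum {ι : Type*} (s : Finset ι) (x : ι → Fin n → ℤ) :
    toReal (∑ i ∈ s, x i) = ∑ i ∈ s, toReal (x i) := map_sum (toRealHom n) x s

theorem toReal_zsmul (m : ℤ) (x : Fin n → ℤ) : toReal (m • x) = (m : ℝ) • toReal x := by
  ext i
  simp only [toReal, Pi.smul_apply, smul_eq_mul, Int.cast_mul]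

theorem toReal_nsmul (m : ℕ) (x : Fin n → ℤ) : toReal (m • x) = (m : ℝ) • toReal x := by
  rw [← natCast_zsmul, toReal_zsmul, Int.cast_natCast]

theorem span_range_toReal : Submodule.span ℝ (Set.range (toReal (n := n))) = ⊤ := by
  rw [eq_top_iff, ← (Pi.basisFun ℝ (Fin n)).span_eq, Submodule.span_le, Set.range_subset_iff]
  refine fun i => Submodule.subset_span ⟨Pi.single i 1, ?_⟩
  ext j
  rw [Pi.basisFun_apply, toReal, Pi.single_apply, Pi.single_apply, Int.cast_ite, Int.cast_one,
    Int.cast_zero]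

theorem det_toReal (u : Fin n → Fin n → ℤ) :
    (Matrix.of fun i => toReal (u i)).det = ((Matrix.of u).det : ℝ) := by
  rw [Int.cast_det]
  rfl

theorem IsPrimitiveVector.gcd_eq_one {r : Fin n → ℤ} (hr : IsPrimitiveVector r) :
    Finset.univ.gcd r = 1 := by
  have hunit : IsUnit (Finset.univ.gcd r) :=
    hr _ fun i => Finset.gcd_dvd (Finset.mem_univ i)
  rw [← Finset.normalize_gcd, normalize_eq_one.2 hunit]

theorem IsPrimitiveVector.ne_zero {r : Fin n → ℤ} (hr : IsPrimitiveVector r) : r ≠ 0 := by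
  rintro rfl
  exact not_isUnit_zero (hr 0 fun _ => dvd_zero _)

theorem exists_isPrimitiveVector_eq_zsmul {k : Fin n → ℤ} (hk : k ≠ 0) :
    ∃ r, IsPrimitiveVector r ∧ ∃ m : ℤ, 0 < m ∧ k = m • r := by
  obtain ⟨i, hi⟩ := Function.ne_iff.1 hk
  obtain ⟨r, hr, hgcd⟩ := Finset.extract_gcd k ⟨i, Finset.mem_univ i⟩
  have hne : Finset.univ.gcd k ≠ 0 := fun h => hi (Finset.gcd_eq_zero_iff.1 h i (Finset.mem_univ i))
  have hnonneg : 0 ≤ Finset.univ.gcd k := Int.nonneg_of_normalize_eq_self Finset.normalize_gcd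
  refine ⟨r, fun d hd => ?_, Finset.univ.gcd k, hnonneg.lt_of_ne' hne,
    funext fun j => hr j (Finset.mem_univ j)⟩
  rw [isUnit_iff_dvd_one, ← hgcd]
  exact Finset.dvd_gcd fun j _ => hd j

theorem IsPrimitiveVector.exists_int_eq {r k : Fin n → ℤ} (hr : IsPrimitiveVector r) {c : ℝ}
    (h : c • toReal r = toReal k) : ∃ m : ℤ, c = m := by
  obtain ⟨a, ha⟩ := Finset.gcd_eq_sum_mul Finset.univ r
  rw [hr.gcd_eq_one] at ha
  refine ⟨∑ i, k i * a i, ?_⟩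
  have hk (i : Fin n) : c * r i = k i := congrFun h i
  calc c = c * ((1 : ℤ) : ℝ) := by rw [Int.cast_one, mul_one]
    _ = ∑ i, c * r i * a i := by
      rw [ha, Int.cast_sum, Finset.mul_sum]
      exact Finset.sum_congr rfl fun i _ => by rw [Int.cast_mul, mul_assoc]
    _ = ((∑ i, k i * a i : ℤ) : ℝ) := by
      rw [Int.cast_sum]
      exact Finset.sum_congr rfl fun i _ => by rw [hk, Int.cast_mul]

theorem finite_setOf_zsmul_eq {k : Fin n → ℤ} (hk : k ≠ 0) :
    {r : Fin n → ℤ | ∃ m : ℤ, m • r = k}.Finite := by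
  refine (Set.finite_Icc (-|k|) |k|).subset ?_
  rintro r ⟨m, rfl⟩
  have hm : m ≠ 0 := fun h => hk (by rw [h, zero_smul])
  have hle : |r| ≤ |m • r| := fun i => by
    rw [Pi.abs_apply, Pi.abs_apply, Pi.smul_apply, smul_eq_mul, abs_mul]
    exact le_mul_of_one_le_left (abs_nonneg _) (Int.one_le_abs hm)
  exact ⟨neg_le.1 ((neg_le_abs r).trans hle), (le_abs_self r).trans hle⟩

theorem card_quotient_le_natAbs_det (H : AddSubgroup (Fin n → ℤ)) (u : Fin n → Fin n → ℤ)
    (hu : ∀ i, u i ∈ H) (hdet : (Matrix.of u).det ≠ 0) :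
    ENat.card ((Fin n → ℤ) ⧸ H) ≤ ((Matrix.of u).det.natAbs : ℕ∞) := by
  have hli : LinearIndependent ℤ u := Matrix.linearIndependent_rows_of_det_ne_zero hdet
  let N : Submodule ℤ (Fin n → ℤ) := Submodule.span ℤ (Set.range u)
  have hN : (Matrix.of u).det.natAbs = N.toAddSubgroup.index := by
    have hspan : (↑) ∘ Module.Basis.span hli = u :=
      funext fun i => congrArg Subtype.val (Module.Basis.span_apply hli i)
    rw [AddSubgroup.index_eq_card]
    have hcard :=
      Submodule.natAbs_det_basis_change (Pi.basisFun ℤ (Fin n)) N (Module.Basis.span hli)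
    rwa [hspan, Pi.basisFun_det] at hcard
  have hNH : N.toAddSubgroup ≤ H := by
    have hle : N ≤ AddSubgroup.toIntSubmodule H := Submodule.span_le.2 (Set.range_subset_iff.2 hu)
    exact hle
  have hpos : 0 < N.toAddSubgroup.index := hN ▸ Int.natAbs_pos.2 hdet
  have hdvd : H.index ∣ N.toAddSubgroup.index := AddSubgroup.index_dvd_of_le hNH
  have hindex : H.FiniteIndex := ⟨(Nat.pos_of_dvd_of_pos hdvd hpos).ne'⟩
  have hfinite : Finite ((Fin n → ℤ) ⧸ H) := AddSubgroup.finite_quotient_of_finiteIndex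
  rw [ENat.card_eq_coe_natCard, ← AddSubgroup.index_eq_card, hN]
  exact_mod_cast Nat.le_of_dvd hpos hdvd

theorem absDet_eq_natAbs_det {s : Finset (Fin n → ℤ)} (hs : s.card = n) {r : Fin n → Fin n → ℤ}
    (hr : Function.Injective r) (hrs : ∀ i, r i ∈ s) : absDet s hs = (Matrix.of r).det.natAbs := by
  have hbij : Function.Bijective fun i => (⟨r i, hrs i⟩ : s) := by
    rw [Fintype.bijective_iff_injective_and_card, Fintype.card_fin, Fintype.card_coe]
    exact ⟨fun i j hij => hr (congrArg Subtype.val hij), hs.symm⟩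
  let σ : Equiv.Perm (Fin n) := (s.equivFinOfCardEq hs).symm.trans (Equiv.ofBijective _ hbij).symm
  have hσ (i : Fin n) : r (σ i) = (s.equivFinOfCardEq hs).symm i :=
    congrArg Subtype.val ((Equiv.ofBijective _ hbij).apply_symm_apply _)
  have hmatrix : (Matrix.of fun i => ((s.equivFinOfCardEq hs).symm i : Fin n → ℤ)) =
      (Matrix.of r).submatrix σ id :=
    Matrix.ext fun i j => congrFun (hσ i).symm j
  rw [absDet, hmatrix, Matrix.det_permute, Int.natAbs_mul, Int.cast_id, Int.units_natAbs, one_mul]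

theorem natAbs_det_le_starDet {C : Set (Fin n → ℝ)} {v : Fin n → ℝ}
    (hfin : (edgeVectors C v).Finite) {r : Fin n → Fin n → ℤ} (hr : ∀ i, r i ∈ edgeVectors C v) :
    (Matrix.of r).det.natAbs ≤ starDet C v := by
  by_cases hinj : Function.Injective r
  · let s : Finset (Fin n → ℤ) := Finset.univ.map ⟨r, hinj⟩
    have hrs (i : Fin n) : r i ∈ s := Finset.mem_map_of_mem _ (Finset.mem_univ i)
    have hs : s.card = n := by rw [Finset.card_map, Finset.card_univ, Fintype.card_fin]
    have hsub : (s : Set (Fin n → ℤ)) ⊆ edgeVectors C v := fun x hx => by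
      obtain ⟨i, -, rfl⟩ := Finset.mem_map.1 hx
      exact hr i
    have hfinite : Finite {s : Finset (Fin n → ℤ) // ↑s ⊆ edgeVectors C v ∧ s.card = n} :=
      ((hfin.finite_subsets.preimage Finset.coe_injective.injOn).subset
        fun s hs => hs.1).to_subtype
    rw [← absDet_eq_natAbs_det hs hinj hrs]
    exact single_le_finsum (⟨s, hsub, hs⟩ :
      {s : Finset (Fin n → ℤ) // ↑s ⊆ edgeVectors C v ∧ s.card = n}) (Set.toFinite _)
      (f := fun s => absDet s.1 s.2.2) fun _ => Nat.zero_le _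
  · obtain ⟨i, j, hij, hne⟩ := Function.not_injective_iff.1 hinj
    rw [Matrix.det_zero_of_row_eq hne (M := Matrix.of r) hij, Int.natAbs_zero]
    exact Nat.zero_le _

end IntegerVectors

section PositivePoints

variable {n : ℕ} {ι : Type*} {L : ι → Module.Dual ℝ (Fin n → ℝ)}

/-- The integer points of the open polyhedral cone cut out by the linear forms `L i`. For an
irrational simplicial cone they are the nonzero integer points of the cone. -/
def positivePoints (L : ι → Module.Dual ℝ (Fin n → ℝ)) : Set (Fin n → ℤ) :=
  {z | ∀ i, 0 < L i (toReal z)}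

theorem add_mem_positivePoints {x y : Fin n → ℤ} (hx : x ∈ positivePoints L)
    (hy : y ∈ positivePoints L) : x + y ∈ positivePoints L := fun i => by
  rw [toReal_add, map_add]
  exact add_pos (hx i) (hy i)

theorem exists_nsmul_add_mem_positivePoints [Finite ι] {w : Fin n → ℤ}
    (hw : w ∈ positivePoints L) (z : Fin n → ℤ) : ∃ k : ℕ, k • w + z ∈ positivePoints L := by
  have hex (i : ι) : ∃ k : ℕ, -L i (toReal z) < k • L i (toReal w) := by
    obtain ⟨k, hk⟩ := Archimedean.arch (-L i (toReal z)) (hw i)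
    exact ⟨k + 1, hk.trans_lt (nsmul_lt_nsmul_left (hw i) k.lt_succ_self)⟩
  choose k hk using hex
  obtain ⟨m, hm⟩ := (Set.finite_range k).bddAbove
  refine ⟨m, fun i => ?_⟩
  have hle : k i • L i (toReal w) ≤ m • L i (toReal w) :=
    nsmul_le_nsmul_left (hw i).le (hm ⟨i, rfl⟩)
  rw [toReal_add, toReal_nsmul, map_add, map_smul, Nat.cast_smul_eq_nsmul]
  linarith [hk i]

theorem mem_positivePoints_of_sum_smul {κ : Type*} [Fintype κ] {p : κ → Fin n → ℤ}
    (hp : ∀ k, p k ∈ positivePoints L) {c : κ → ℝ} (hc : ∀ k, 0 ≤ c k) (hc' : ∃ k, 0 < c k)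
    {x : Fin n → ℤ} (hx : toReal x = ∑ k, c k • toReal (p k)) : x ∈ positivePoints L := fun i => by
  obtain ⟨k, hk⟩ := hc'
  rw [hx, map_sum]
  refine Finset.sum_pos' (fun j _ => ?_) ⟨k, Finset.mem_univ k, ?_⟩ <;> rw [map_smul, smul_eq_mul]
  exacts [mul_nonneg (hc j) (hp j i).le, mul_pos hk (hp k i)]

theorem add_mem_positivePoints_of_zsmul {w r : Fin n → ℤ} (hw : w ∈ positivePoints L) {m : ℤ}
    (hm : 0 < m) (h : w + m • r ∈ positivePoints L) : w + r ∈ positivePoints L := fun i => by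
  have hm : (1 : ℝ) ≤ m := by exact_mod_cast hm
  have h₀ := hw i
  have h₁ := h i
  rw [toReal_add, toReal_zsmul, map_add, map_smul, smul_eq_mul] at h₁
  rw [toReal_add, map_add]
  nlinarith

theorem eq_zero_of_forall_positivePoints_apply_nonpos [Finite ι] {w : Fin n → ℤ}
    (hw : w ∈ positivePoints L) {l : StrongDual ℝ (Fin n → ℝ)} (hlw : l (toReal w) = 0)
    (hl : ∀ z ∈ positivePoints L, l (toReal z) ≤ 0) : l = 0 := by
  have hnonpos (z : Fin n → ℤ) : l (toReal z) ≤ 0 := by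
    obtain ⟨k, hk⟩ := exists_nsmul_add_mem_positivePoints hw z
    have hle := hl _ hk
    rwa [toReal_add, toReal_nsmul, map_add, map_smul, hlw, smul_zero, zero_add] at hle
  have hzero (z : Fin n → ℤ) : l (toReal z) = 0 := by
    have hneg := hnonpos (-z)
    rw [toReal_neg, map_neg, neg_nonpos] at hneg
    exact (hnonpos z).antisymm hneg
  exact ContinuousLinearMap.coe_injective (LinearMap.ext_on_range span_range_toReal hzero)

theorem IsLocalFrame.span_eq_top [Finite ι] {Y : Set (Fin n → ℝ)} {w : Fin n → ℤ}
    (hY : IsLocalFrame (convexHull ℝ (toReal '' positivePoints L)) (toReal w) Y)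
    (hw : w ∈ positivePoints L) : Submodule.span ℝ Y = ⊤ := by
  have hmem {z : Fin n → ℤ} (hz : z ∈ positivePoints L) :
      toReal z - toReal w ∈ Submodule.span ℝ Y :=
    PointedCone.hull_le_span ℝ _ (hY.sub_mem_hull _ (subset_convexHull ℝ _ ⟨z, hz, rfl⟩))
  have hwspan : toReal w ∈ Submodule.span ℝ Y := by
    have h := hmem (add_mem_positivePoints hw hw)
    rwa [toReal_add, add_sub_cancel_right] at h
  rw [eq_top_iff, ← span_range_toReal, Submodule.span_le, Set.range_subset_iff]
  intro z
  obtain ⟨k, hk⟩ := exists_nsmul_add_mem_positivePoints hw z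
  have h := Submodule.add_mem _ (hmem hk) hwspan
  rw [sub_add_cancel, toReal_add, toReal_nsmul] at h
  exact (Submodule.add_mem_iff_right _ (Submodule.smul_mem _ _ hwspan)).1 h

theorem exists_irredundant_isLocalFrame [Finite ι] {w : Fin n → ℤ} (hw : w ∈ positivePoints L)
    {f : StrongDual ℝ (Fin n → ℝ)}
    (hf : ∀ z ∈ positivePoints L, z ≠ w → f (toReal w) < f (toReal z)) :
    ∃ Y ⊆ toReal '' {k | w + k ∈ positivePoints L ∧ 0 < f (toReal k)}, Y.Finite ∧
      IsLocalFrame (convexHull ℝ (toReal '' positivePoints L)) (toReal w) Y ∧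
      ∀ y ∈ Y, y ∉ PointedCone.hull ℝ (Y \ {y}) := by
  let Q : Set (Fin n → ℤ) := {z | ∀ i, 0 < L i (toReal w) + L i (toReal z)}
  have hadd {z : Fin n → ℤ} (hz : z ∈ Q) : w + z ∈ positivePoints L := fun i => by
    rw [toReal_add, map_add]
    exact hz i
  have hfQ : ∀ z ∈ Q, z ≠ 0 → 0 < f (toReal z) := fun z hz hz₀ => by
    simpa only [toReal_add, map_add, lt_add_iff_pos_right] using
      hf _ (hadd hz) (add_ne_left.2 hz₀)
  obtain ⟨G, hG, hGfin, hgen⟩ := exists_finite_subset_closure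
    (partiallyWellOrderedOn_sub_mem hw fun i => (L i).toAddMonoidHom.comp (toRealHom n))
    (f := f.toLinearMap.toAddMonoidHom.comp (toRealHom n)) hfQ
  obtain ⟨Y, hYG, hhull, hirr⟩ := exists_irredundant_hull_eq (hGfin.image toReal)
  have hmem {y : Fin n → ℝ} (hy : y ∈ Y) :
      ∃ k, w + k ∈ positivePoints L ∧ 0 < f (toReal k) ∧ toReal k = y := by
    obtain ⟨k, hk, rfl⟩ := hYG hy
    exact ⟨k, hadd (hG hk).1, hfQ k (hG hk).1 (hG hk).2, rfl⟩
  refine ⟨Y, fun y hy => ?_, (hGfin.image toReal).subset hYG,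
    isLocalFrame_convexHull ⟨w, hw, rfl⟩ (fun y hy => ?_) ?_, hirr⟩
  · obtain ⟨k, hk, hfk, rfl⟩ := hmem hy
    exact ⟨k, ⟨hk, hfk⟩, rfl⟩
  · obtain ⟨k, hk, -, rfl⟩ := hmem hy
    exact ⟨w + k, hk, toReal_add w k⟩
  · rintro _ ⟨z, hz, rfl⟩
    have hzQ : z - w ∈ Q := fun i => by
      rw [toReal_sub, map_sub, add_sub_cancel]
      exact hz i
    have hle : AddSubmonoid.closure G ≤
        (PointedCone.hull ℝ Y).toAddSubmonoid.comap (toRealHom n) := by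
      rw [AddSubmonoid.closure_le, hhull]
      exact fun k hk => PointedCone.subset_hull ⟨k, hk, rfl⟩
    exact toReal_sub z w ▸ hle (hgen hzQ)

end PositivePoints

/-! ### Vertices of the Klein polyhedron -/

section EdgeStar

variable {n : ℕ} {C Y : Set (Fin n → ℝ)} {w : Fin n → ℤ} {f : StrongDual ℝ (Fin n → ℝ)}

theorem IsLocalFrame.exists_mem_edgeVectors (hn : n ≠ 1)
    (hY : IsLocalFrame (kleinPolyhedron C) (toReal w) Y) (hfin : Y.Finite)
    (hf : ∀ y ∈ Y, 0 < f y) {k : Fin n → ℤ} (hk : toReal k ∈ Y)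
    (hirr : toReal k ∉ PointedCone.hull ℝ (Y \ {toReal k})) :
    ∃ r ∈ edgeVectors C (toReal w), ∃ m : ℤ, 0 < m ∧ k = m • r := by
  have hk₀ : k ≠ 0 := by
    rintro rfl
    exact (hf _ hk).ne' (by rw [toReal_zero, map_zero])
  obtain ⟨r, hr, m, hm, rfl⟩ := exists_isPrimitiveVector_eq_zsmul hk₀
  obtain ⟨E, hE, hwE, hwkE, hdim⟩ := hY.exists_isExposed_finrank_eq_one hfin hf hk hirr
  have hsail : E ⊆ sail C := subset_frontier_of_isExposed hE (by
    rwa [hdim, Module.finrank_fin_fun, ne_comm])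
  refine ⟨r, ⟨hr, E, ⟨⟨⟨_, hwE⟩, hE, hdim⟩, hsail⟩, hwE, m, by exact_mod_cast hm, ?_⟩, m, hm, rfl⟩
  rwa [← toReal_zsmul]

theorem IsLocalFrame.exists_mem_eq_zsmul (hY : IsLocalFrame (kleinPolyhedron C) (toReal w) Y)
    (hint : Y ⊆ Set.range toReal) (hf : ∀ y ∈ Y, 0 < f y) {r : Fin n → ℤ}
    (hr : r ∈ edgeVectors C (toReal w)) : ∃ k, toReal k ∈ Y ∧ ∃ m : ℤ, 0 < m ∧ k = m • r := by
  obtain ⟨hprim, E, ⟨⟨-, hE, hdim⟩, -⟩, hwE, t, ht, hwrE⟩ := hr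
  have hr₀ : toReal r ≠ 0 := toReal_zero (n := n) ▸ toReal_injective.ne hprim.ne_zero
  obtain ⟨y, hy, c, hc, hyc⟩ := hY.exists_mem_eq_smul_of_isExposed hf hE hdim hwE
    (smul_ne_zero ht.ne' hr₀) hwrE
  obtain ⟨k, rfl⟩ := hint hy
  rw [smul_smul] at hyc
  obtain ⟨m, hm⟩ := hprim.exists_int_eq hyc.symm
  rw [hm, ← toReal_zsmul] at hyc
  exact ⟨k, hy, m, by exact_mod_cast hm ▸ mul_pos hc ht, toReal_injective hyc⟩

theorem isLocalFrame_edgeVectors {ι : Type*} [Finite ι] {L : ι → Module.Dual ℝ (Fin n → ℝ)}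
    (hn : n ≠ 1) (hK : kleinPolyhedron C = convexHull ℝ (toReal '' positivePoints L))
    (hw : w ∈ positivePoints L)
    (hf : ∀ z ∈ positivePoints L, z ≠ w → f (toReal w) < f (toReal z)) :
    (edgeVectors C (toReal w)).Finite ∧
      (∀ r ∈ edgeVectors C (toReal w), w + r ∈ positivePoints L) ∧
      IsLocalFrame (kleinPolyhedron C) (toReal w) (toReal '' edgeVectors C (toReal w)) := by
  obtain ⟨Y, hYP, hfin, hY, hirr⟩ := exists_irredundant_isLocalFrame hw hf
  rw [← hK] at hY
  have hint : Y ⊆ Set.range toReal := hYP.trans (Set.image_subset_range _ _)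
  have hfY : ∀ y ∈ Y, 0 < f y := fun y hy => by
    obtain ⟨k, hk, rfl⟩ := hYP hy
    exact hk.2
  have hmem {r : Fin n → ℤ} (hr : r ∈ edgeVectors C (toReal w)) : w + r ∈ positivePoints L := by
    obtain ⟨k, hk, m, hm, rfl⟩ := hY.exists_mem_eq_zsmul hint hfY hr
    obtain ⟨k', hk', heq⟩ := hYP hk
    exact add_mem_positivePoints_of_zsmul hw hm (toReal_injective heq ▸ hk'.1)
  refine ⟨?_, fun r hr => hmem hr, hY.mem, ?_, fun x hx => ?_⟩
  · refine ((hfin.preimage toReal_injective.injOn).biUnion fun k hk =>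
      finite_setOf_zsmul_eq (k := k) ?_).subset fun r hr => ?_
    · rintro rfl
      exact (hfY _ hk).ne' (by rw [toReal_zero, map_zero])
    · obtain ⟨k, hk, m, -, hkr⟩ := hY.exists_mem_eq_zsmul hint hfY hr
      exact Set.mem_biUnion hk ⟨m, hkr.symm⟩
  · rintro _ ⟨r, hr, rfl⟩
    rw [hK, ← toReal_add]
    exact subset_convexHull ℝ _ ⟨w + r, hmem hr, rfl⟩
  · have hle : PointedCone.hull ℝ Y ≤
        PointedCone.hull ℝ (toReal '' edgeVectors C (toReal w)) := by
      refine Submodule.span_le.2 fun y hy => ?_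
      obtain ⟨k, rfl⟩ := hint hy
      obtain ⟨r, hr, m, hm, rfl⟩ := hY.exists_mem_edgeVectors hn hfin hfY hy (hirr _ hy)
      rw [toReal_zsmul]
      exact PointedCone.smul_mem _ (by exact_mod_cast hm.le)
        (PointedCone.subset_hull ⟨r, hr, rfl⟩)
    exact hle (hY.sub_mem_hull x hx)

end EdgeStar

section Descent

variable {n : ℕ} {ι κ : Type*} [Fintype κ] {L : ι → Module.Dual ℝ (Fin n → ℝ)} {w : Fin n → ℤ}
  {f : Module.Dual ℝ (Fin n → ℝ)}

-- If the sum were larger, `(1 + ∑ y k) • w - ∑ y k • p k`, with `y` an approximation of `α`,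
-- would be a point of the cone on which `f` is smaller than at its minimum `w`.
theorem sum_le_of_eq_sum_smul [Nonempty κ]
    (hf : ∀ z ∈ positivePoints L, z ≠ w → f (toReal w) < f (toReal z)) {p : κ → Fin n → ℤ}
    (hp : ∀ k, p k ∈ positivePoints L) (hpw : ∀ k, p k ≠ w) {α : κ → ℝ} (h₀ : ∀ k, 0 ≤ α k)
    (h₁ : ∑ k, α k ≤ 1) (hw : toReal w = ∑ k, α k • toReal (p k)) :
    ∑ k, α k ≤ 1 - 1 / (scale (Fintype.card κ) (Fintype.card κ) : ℝ) := by
  by_contra! hlt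
  obtain ⟨y, hy, hle, k, hk⟩ := exists_nat_le_one_add_sum_mul h₀ h₁ hlt
  let x : Fin n → ℤ := (1 + ∑ k, y k) • w - ∑ k, y k • p k
  have hx : toReal x = ∑ k, ((1 + (∑ k, y k : ℕ)) * α k - y k) • toReal (p k) := by
    simp only [x, toReal_sub, toReal_sum, toReal_nsmul, sub_smul, mul_smul, Finset.sum_sub_distrib,
      ← Finset.smul_sum, ← hw, Nat.cast_add, Nat.cast_one]
  have hxmem : x ∈ positivePoints L :=
    mem_positivePoints_of_sum_smul hp (fun k => sub_nonneg.2 (hle k)) ⟨k, sub_pos.2 hk⟩ hx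
  have hfx : f (toReal x) < f (toReal w) := by
    have hsum : ∑ k, y k * f (toReal w) < ∑ k, y k * f (toReal (p k)) := by
      obtain ⟨j, -, hj⟩ := Finset.exists_ne_zero_of_sum_ne_zero hy.ne'
      refine Finset.sum_lt_sum (fun k _ => ?_) ⟨j, Finset.mem_univ j, ?_⟩
      · exact mul_le_mul_of_nonneg_left (hf _ (hp k) (hpw k)).le (y k).cast_nonneg
      · exact mul_lt_mul_of_pos_left (hf _ (hp j) (hpw j)) (by exact_mod_cast hj.bot_lt)
    rw [← Finset.sum_mul] at hsum
    simp only [x, toReal_sub, toReal_sum, toReal_nsmul, map_sub, map_sum, map_smul, smul_eq_mul]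
    push_cast
    linarith
  rcases eq_or_ne x w with hxw | hxw
  · exact hfx.ne (by rw [hxw])
  · exact hfx.not_gt (hf x hxmem hxw)

theorem sum_add_one_le_scale [Nonempty κ]
    (hf : ∀ z ∈ positivePoints L, z ≠ w → f (toReal w) < f (toReal z)) {r : κ → Fin n → ℤ}
    (hr : ∀ k, w + r k ∈ positivePoints L) (hr₀ : ∀ k, r k ≠ 0) {c : κ → ℝ} (hc : ∀ k, 0 ≤ c k)
    (hw : toReal w = ∑ k, c k • toReal (r k)) :
    ∑ k, c k + 1 ≤ scale (Fintype.card κ) (Fintype.card κ) := by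
  set S := ∑ k, c k with hS
  have hpos : 0 < S + 1 := add_pos_of_nonneg_of_pos (Finset.sum_nonneg fun k _ => hc k) one_pos
  have hsum : ∑ k, c k / (S + 1) = 1 - 1 / (S + 1) := by
    rw [← Finset.sum_div, ← hS, one_sub_div hpos.ne', add_sub_cancel_right]
  have hw' : toReal w = ∑ k, (c k / (S + 1)) • toReal (w + r k) := by
    have hterm : ∑ k, (c k / (S + 1)) • toReal (r k) = (1 / (S + 1)) • toReal w := by
      rw [hw, Finset.smul_sum]
      exact Finset.sum_congr rfl fun k _ => by rw [smul_smul, one_div_mul_eq_div]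
    simp only [toReal_add, smul_add, Finset.sum_add_distrib, ← Finset.sum_smul]
    rw [hsum, hterm, sub_smul, one_smul, sub_add_cancel]
  have hle := sum_le_of_eq_sum_smul hf hr (fun k => add_ne_left.2 (hr₀ k))
    (fun k => div_nonneg (hc k) hpos.le) (hsum.trans_le (sub_le_self _ (by positivity))) hw'
  rw [hsum, sub_le_sub_iff_left] at hle
  exact (one_div_le_one_div (by exact_mod_cast scale_pos Fintype.card_pos _) hpos).1 hle

end Descent

/-! ### Integer distance of facets -/

section Facets

variable {m : ℕ}

theorem det_ne_zero_of_linearIndependent_toReal {n : ℕ} {u : Fin n → Fin n → ℤ}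
    (hu : LinearIndependent ℝ fun i => toReal (u i)) : (Matrix.of u).det ≠ 0 := fun h => by
  have hunit : IsUnit (Matrix.of fun i => toReal (u i)) :=
    Matrix.linearIndependent_rows_iff_isUnit.1 hu
  rw [Matrix.isUnit_iff_isUnit_det, det_toReal, h, Int.cast_zero] at hunit
  exact not_isUnit_zero hunit

theorem intDist_zero_le_natAbs_det {F : Set (Fin (m + 1) → ℝ)} {w : Fin (m + 1) → ℤ}
    {g : Fin m → Fin (m + 1) → ℤ} (hw : toReal w ∈ F) (hg : ∀ j, toReal (w + g j) ∈ F)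
    (hdet : (Matrix.of (Matrix.vecCons w g)).det ≠ 0) :
    intDist F 0 ≤ ((Matrix.of (Matrix.vecCons w g)).det.natAbs : ℕ∞) := by
  have hmem {z : Fin (m + 1) → ℤ} (hz : toReal z ∈ F) :
      z ∈ AddSubgroup.closure {z : Fin (m + 1) → ℤ | toReal (z + 0) ∈ affineSpan ℝ F} :=
    AddSubgroup.subset_closure (subset_affineSpan ℝ F (by rwa [add_zero]))
  refine card_quotient_le_natAbs_det _ _ (Fin.cases (hmem hw) fun j => ?_) hdet
  have hsub := sub_mem (hmem (hg j)) (hmem hw)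
  rwa [add_sub_cancel_left] at hsub

theorem natAbs_det_vecCons_le {κ : Type*} [Fintype κ] {w : Fin (m + 1) → ℤ}
    {r : κ → Fin (m + 1) → ℤ} {c : κ → ℝ} (hc : ∀ k, 0 ≤ c k)
    (hw : toReal w = ∑ k, c k • toReal (r k)) (g : Fin m → Fin (m + 1) → ℤ) {D : ℕ}
    (hD : ∀ k, (Matrix.of (Matrix.vecCons (r k) g)).det.natAbs ≤ D) :
    ((Matrix.of (Matrix.vecCons w g)).det.natAbs : ℝ) ≤ (∑ k, c k) * D := by
  let detRow : (Fin (m + 1) → ℝ) →ₗ[ℝ] ℝ :=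
    Matrix.detRowAlternating.toMultilinearMap.toLinearMap (Fin.cons 0 fun j => toReal (g j)) 0
  have hdet (z : Fin (m + 1) → ℤ) :
      ((Matrix.of (Matrix.vecCons z g)).det : ℝ) = detRow (toReal z) := by
    rw [← det_toReal, MultilinearMap.toLinearMap_apply, Fin.update_cons_zero]
    exact congrArg Matrix.det (funext (Fin.cases rfl fun j => rfl))
  have hsum : ((Matrix.of (Matrix.vecCons w g)).det : ℝ) =
      ∑ k, c k * ((Matrix.of (Matrix.vecCons (r k) g)).det : ℝ) := by
    simp only [hdet, hw, map_sum, map_smul, smul_eq_mul]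
  rw [Nat.cast_natAbs, Int.cast_abs, hsum, Finset.sum_mul]
  refine (Finset.abs_sum_le_sum_abs _ _).trans (Finset.sum_le_sum fun k _ => ?_)
  rw [abs_mul, abs_of_nonneg (hc k), ← Int.cast_abs, ← Nat.cast_natAbs]
  exact mul_le_mul_of_nonneg_left (by exact_mod_cast hD k) (hc k)

theorem exists_facet_edgeVectors {ι : Type*} [Finite ι]
    {L : ι → Module.Dual ℝ (Fin (m + 1) → ℝ)} {C F : Set (Fin (m + 1) → ℝ)} {w : Fin (m + 1) → ℤ}
    (hK : kleinPolyhedron C = convexHull ℝ (toReal '' positivePoints L))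
    (hw : w ∈ positivePoints L)
    (hframe : IsLocalFrame (kleinPolyhedron C) (toReal w) (toReal '' edgeVectors C (toReal w)))
    (hF : IsFaceOfDim (kleinPolyhedron C) m F) (hwF : toReal w ∈ F) :
    ∃ g : Fin m → Fin (m + 1) → ℤ, (∀ j, g j ∈ edgeVectors C (toReal w)) ∧
      (∀ j, toReal (w + g j) ∈ F) ∧
      (Matrix.of (Matrix.vecCons w g)).det ≠ 0 := by
  obtain ⟨-, hexp, hdim⟩ := hF
  obtain ⟨l, hl⟩ := hexp ⟨_, hwF⟩
  change F = l.toExposed (kleinPolyhedron C) at hl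
  subst hl
  have hlw : l (toReal w) ≠ 0 := fun hlw => by
    have hl₀ : l = 0 := eq_zero_of_forall_positivePoints_apply_nonpos hw hlw fun z hz =>
      hlw ▸ hwF.2 _ (hK ▸ subset_convexHull ℝ _ ⟨z, hz, rfl⟩)
    have hdir := hframe.direction_affineSpan_toExposed hwF
    rw [hl₀] at hdim hdir
    simp only [zero_apply, and_true, Set.ofPred_mem_eq, (hK ▸ hframe).span_eq_top hw] at hdir
    rw [hdir, finrank_top, Module.finrank_fin_fun] at hdim
    omega
  obtain ⟨y, hy, hli⟩ := hframe.exists_linearIndependent_of_mem_toExposed hwF hdim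
  choose g hg hgy using fun j => (hy j).1
  obtain rfl : (fun j => toReal (g j)) = y := funext hgy
  have hgF (j : Fin m) : toReal (w + g j) ∈ l.toExposed (kleinPolyhedron C) :=
    toReal_add w (g j) ▸ hframe.add_mem_toExposed hwF (hy j).1 (hy j).2
  refine ⟨g, hg, hgF, det_ne_zero_of_linearIndependent_toReal ?_⟩
  have hker : Submodule.span ℝ (Set.range fun j => toReal (g j)) ≤ l.toLinearMap.ker :=
    Submodule.span_le.2 (Set.range_subset_iff.2 fun j => (hy j).2)
  have hcons : LinearIndependent ℝ
      (Fin.cons (toReal w) fun j => toReal (g j) : Fin (m + 1) → Fin (m + 1) → ℝ) :=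
    linearIndependent_finCons.2 ⟨hli, fun hmem => hlw (hker hmem)⟩
  convert hcons using 1
  exact funext (Fin.cases rfl fun j => rfl)

end Facets

section IntegerDistance

variable {n : ℕ} {ι : Type*} {L : ι → Module.Dual ℝ (Fin n → ℝ)}
  {C : Set (Fin n → ℝ)} {w : Fin n → ℤ}

theorem exists_eq_sum_smul_edgeVectors
    (hK : kleinPolyhedron C = convexHull ℝ (toReal '' positivePoints L))
    (hw : w ∈ positivePoints L)
    (hframe : IsLocalFrame (kleinPolyhedron C) (toReal w) (toReal '' edgeVectors C (toReal w))) :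
    ∃ t : Finset (Fin n → ℤ), ↑t ⊆ edgeVectors C (toReal w) ∧ t.card ≤ n ∧
      ∃ c : t → ℝ, (∀ r, 0 ≤ c r) ∧ toReal w = ∑ r, c r • toReal r := by
  have hwhull : toReal w ∈ PointedCone.hull ℝ (toReal '' edgeVectors C (toReal w)) := by
    have h := hframe.sub_mem_hull (toReal (w + w))
      (hK ▸ subset_convexHull ℝ _ ⟨_, add_mem_positivePoints hw hw, rfl⟩)
    rwa [toReal_add, add_sub_cancel_right] at h
  obtain ⟨t, ht, hli, hwt⟩ := exists_linearIndepOn_mem_hull hwhull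
  obtain ⟨c, hc, hcw⟩ := mem_hull_finset.1 hwt
  have hcard : t.card ≤ n := by
    simpa only [Finset.coe_sort_coe, Fintype.card_coe, Module.finrank_fin_fun] using
      LinearIndependent.fintype_card_le_finrank hli
  obtain ⟨t, htC, rfl⟩ := Finset.subset_set_image_iff.1 ht
  rw [Finset.card_image_of_injective _ toReal_injective] at hcard
  rw [Finset.sum_image toReal_injective.injOn, ← Finset.sum_coe_sort] at hcw
  exact ⟨t, htC, hcard, fun r => c (toReal r),
    fun r => hc _ (Finset.mem_image_of_mem toReal r.2), hcw.symm⟩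

theorem exists_eq_sum_smul_edgeVectors_sum_lt [Finite ι] {f : StrongDual ℝ (Fin n → ℝ)}
    (hn : 2 ≤ n)
    (hK : kleinPolyhedron C = convexHull ℝ (toReal '' positivePoints L))
    (hw : w ∈ positivePoints L)
    (hf : ∀ z ∈ positivePoints L, z ≠ w → f (toReal w) < f (toReal z)) :
    ∃ t : Finset (Fin n → ℤ), ↑t ⊆ edgeVectors C (toReal w) ∧
      ∃ c : t → ℝ, (∀ r, 0 ≤ c r) ∧ toReal w = ∑ r, c r • toReal r ∧
        ∑ r, c r < n ^ (6 * (n !) - 2) := by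
  obtain ⟨-, hmem, hframe⟩ := isLocalFrame_edgeVectors (by omega) hK hw hf
  obtain ⟨t, ht, hcard, c, hc, hsum⟩ := exists_eq_sum_smul_edgeVectors hK hw hframe
  refine ⟨t, ht, c, hc, hsum, ?_⟩
  rcases isEmpty_or_nonempty t with hempty | hnonempty
  · rw [Fintype.sum_empty]
    positivity
  · have hle : ∑ r, c r + 1 ≤ scale t.card t.card := by
      simpa only [Fintype.card_coe] using sum_add_one_le_scale (f := f.toLinearMap) hf
        (fun r : t => hmem r (ht r.2)) (fun r => (ht r.2).1.ne_zero) hc hsum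
    have hscale : scale t.card t.card ≤ n ^ (6 * (n !) - 2) := by
      obtain ⟨j, rfl⟩ : ∃ j, n = j + 1 := ⟨n - 1, by omega⟩
      exact (scale_le_scale hcard _).trans ((scale_monotone (by omega) hcard).trans
        (scale_succ_le_pow hn j))
    exact (lt_add_one _).trans_le (hle.trans (by exact_mod_cast hscale))

theorem intDist_zero_lt_pow_mul_starDet [Finite ι] (hn : 2 ≤ n)
    (hK : kleinPolyhedron C = convexHull ℝ (toReal '' positivePoints L)) {v : Fin n → ℝ}
    (hv : IsExposed ℝ (kleinPolyhedron C) {v}) {F : Set (Fin n → ℝ)}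
    (hF : IsFaceOfDim (kleinPolyhedron C) (n - 1) F) (hvF : v ∈ F) :
    intDist F 0 < (n ^ (6 * (n !) - 2) * starDet C v : ℕ) := by
  obtain ⟨⟨w, hw, rfl⟩, f, hf⟩ := exists_lt_of_isExposed_singleton (hK ▸ hv)
  replace hf : ∀ z ∈ positivePoints L, z ≠ w → f (toReal w) < f (toReal z) := fun z hz hzw =>
    hf _ ⟨z, hz, rfl⟩ (toReal_injective.ne hzw)
  obtain ⟨hfin, -, hframe⟩ := isLocalFrame_edgeVectors (by omega) hK hw hf
  obtain ⟨t, ht, c, hc, hsum, hlt⟩ := exists_eq_sum_smul_edgeVectors_sum_lt hn hK hw hf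
  obtain ⟨m, rfl⟩ : ∃ m, n = m + 1 := ⟨n - 1, by omega⟩
  obtain ⟨g, hg, hgF, hdet⟩ := exists_facet_edgeVectors hK hw hframe hF hvF
  have hle := natAbs_det_vecCons_le hc hsum g fun r =>
    natAbs_det_le_starDet hfin (Fin.cases (ht r.2) hg)
  have hpos : (0 : ℝ) < (Matrix.of (Matrix.vecCons w g)).det.natAbs := by
    exact_mod_cast Int.natAbs_pos.2 hdet
  have hD : (0 : ℝ) < starDet C (toReal w) :=
    pos_of_mul_pos_right (hpos.trans_le hle) (Finset.sum_nonneg fun r _ => hc r)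
  have hdetlt := hle.trans_lt (mul_lt_mul_of_pos_right hlt hD)
  exact (intDist_zero_le_natAbs_det hvF hgF hdet).trans_lt (by exact_mod_cast hdetlt)

end IntegerDistance

theorem kleinPolyhedron_eq_convexHull {n : ℕ} {C : Set (Fin n → ℝ)} {P : Set (Fin n → ℤ)}
    (hC : {z | z ≠ 0 ∧ toReal z ∈ C} = P) :
    kleinPolyhedron C = convexHull ℝ (toReal '' P) := by
  rw [kleinPolyhedron, ← hC]
  congr 1
  ext x
  constructor
  · rintro ⟨hx, z, hz, rfl⟩
    exact ⟨z, ⟨hz, hx⟩, rfl⟩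
  · rintro ⟨z, ⟨hz, hx⟩, rfl⟩
    exact ⟨hx, z, hz, rfl⟩

theorem mem_simplicialCone_iff {n : ℕ} {b : Module.Basis (Fin n) ℝ (Fin n → ℝ)} {x : Fin n → ℝ} :
    x ∈ simplicialCone b ↔ ∀ i, 0 ≤ b.coord i x := by
  constructor
  · rintro ⟨c, hc, rfl⟩ i
    rw [b.coord_apply, b.repr_sum_self]
    exact hc i
  · exact fun hx => ⟨b.repr x, hx, (b.sum_repr x).symm⟩

theorem IsIrrational.setOf_mem_eq_positivePoints {n : ℕ} (hn : n ≠ 0)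
    {b : Module.Basis (Fin n) ℝ (Fin n → ℝ)} (hb : IsIrrational b) :
    {z | z ≠ 0 ∧ toReal z ∈ simplicialCone b} = positivePoints b.coord := by
  ext z
  constructor
  · rintro ⟨hz, hzb⟩ i
    refine (mem_simplicialCone_iff.1 hzb i).lt_of_ne' fun hi => hz (hb {i}ᶜ ?_ z ?_)
    · exact Set.compl_ne_univ.2 (Set.singleton_nonempty i)
    · refine b.mem_span_image.2 fun j hj => ?_
      rintro rfl
      exact Finsupp.mem_support_iff.1 hj hi
  · refine fun hz => ⟨?_, mem_simplicialCone_iff.2 fun i => (hz i).le⟩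
    rintro rfl
    have h := hz ⟨0, hn.bot_lt⟩
    rw [toReal_zero, map_zero] at h
    exact h.false

end KleinSail

open KleinSail in
theorem corollary1_general {n : ℕ} (hn : 2 ≤ n) {ι : Type*} [Finite ι]
    {L : ι → Module.Dual ℝ (Fin n → ℝ)} {C : Set (Fin n → ℝ)}
    (hC : {z | z ≠ 0 ∧ toReal z ∈ C} = positivePoints L) {v : Fin n → ℝ} (hv : IsSailVertex C v)
    {F : Set (Fin n → ℝ)} (hF : IsSailFace C (n - 1) F) (hvF : v ∈ F) :
    intDist F 0 < (((n * starDet C v) ^ (8 * n !) : ℕ) : ℕ∞) := by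
  refine (intDist_zero_lt_pow_mul_starDet hn (kleinPolyhedron_eq_convexHull hC) hv.1.2.1 hF.1
    hvF).trans_le ?_
  have hfactorial : 0 < n ! := n.factorial_pos
  rw [mul_pow]
  exact_mod_cast Nat.mul_le_mul (Nat.pow_le_pow_right (by omega) (by omega))
    (Nat.le_self_pow (by omega) (starDet C v))

theorem corollary1 (n : ℕ) (hn : 2 ≤ n)
    (b : Module.Basis (Fin n) ℝ (Fin n → ℝ)) (hb : KleinSail.IsIrrational b)
    (v : Fin n → ℝ) (hv : KleinSail.IsSailVertex (KleinSail.simplicialCone b) v)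
    (F : Set (Fin n → ℝ)) (hF : KleinSail.IsSailFace (KleinSail.simplicialCone b) (n - 1) F)
    (hvF : v ∈ F) :
    KleinSail.intDist F 0 <
      (((n * KleinSail.starDet (KleinSail.simplicialCone b) v) ^ (8 * n !) : ℕ) : ℕ∞) :=
  corollary1_general hn (hb.setOf_mem_eq_positivePoints (by omega)) hv hF hvF
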